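/- Let $m,n\ge 1$ be integers. An $m$-parking function of size $n$ is a function $f:\{1,\dots,n\}\to\{1,\dots,1+m(n-1)\}$ whose nondecreasing rearrangement $b_1\le b_2\le\cdots\le b_n$ satisfies $b_i\le 1+m(i-1)$ for all $i$; we identify $f$ with the word $f(1)f(2)\cdots f(n)$. The hypoplactic congruence is the smallest two-sided congruence $\equiv$ on the free monoid of words in positive integers such that $$acb\equiv cab\ (a\le b<c),\qquad bac\equiv bca\ (a<b\le c),$$ $$cadb\equiv acbd\ (a\le b<c\le d),\qquad bdac\equiv dbca\ (a<b\le c<d).$$ Then the number of hypoplactic classes of $m$-parking functions of size $n$ is $$\frac1n\sum_{k=1}^n\binom{mn}{k-1}\binom{n}{k}2^{k-1}.$$ -/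

import Mathlib

/-- The defining relations of the hypoplactic monoid over the alphabet `ℕ`: the two Knuth (plactic)
relations together with the two quartic relations. -/
inductive HypoplacticRel : FreeMonoid ℕ → FreeMonoid ℕ → Prop
  | knuth₁ (a b c : ℕ) (hab : a ≤ b) (hbc : b < c) :
      HypoplacticRel (FreeMonoid.ofList [a, c, b]) (FreeMonoid.ofList [c, a, b])
  | knuth₂ (a b c : ℕ) (hab : a < b) (hbc : b ≤ c) :
      HypoplacticRel (FreeMonoid.ofList [b, a, c]) (FreeMonoid.ofList [b, c, a])
  | quartic₁ (a b c d : ℕ) (hab : a ≤ b) (hbc : b < c) (hcd : c ≤ d) :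
      HypoplacticRel (FreeMonoid.ofList [c, a, d, b]) (FreeMonoid.ofList [a, c, b, d])
  | quartic₂ (a b c d : ℕ) (hab : a < b) (hbc : b ≤ c) (hcd : c < d) :
      HypoplacticRel (FreeMonoid.ofList [b, d, a, c]) (FreeMonoid.ofList [d, b, c, a])

/-- The hypoplactic congruence on words: the smallest two-sided congruence of the free monoid
containing the hypoplactic relations. -/
def hypoplacticCon : Con (FreeMonoid ℕ) := conGen HypoplacticRel

/-- `f` is an `m`-parking function of size `n`: its values are positive integers whose nondecreasing
rearrangement `b₁ ≤ ⋯ ≤ bₙ` satisfies `bᵢ ≤ 1 + m (i - 1)` for all `1 ≤ i ≤ n`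
(here the index `i : Fin n` starts at `0`). All values then lie in `{1, …, 1 + m (n - 1)}`. -/
def IsMParkingFunction (m n : ℕ) (f : Fin n → ℕ) : Prop :=
  (∀ i, 1 ≤ f i) ∧ ∀ i : Fin n, f (Tuple.sort f i) ≤ 1 + m * (i : ℕ)

/-- The word `f(1) f(2) ⋯ f(n)` of a function `f`. -/
def functionWord {n : ℕ} (f : Fin n → ℕ) : FreeMonoid ℕ := FreeMonoid.ofList (List.ofFn f)

/-- The hypoplactic classes of `m`-parking functions of size `n`, as elements of the hypoplactic
monoid. -/
def hypoplacticClasses (m n : ℕ) : Set hypoplacticCon.Quotient :=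
  {q | ∃ f : Fin n → ℕ, IsMParkingFunction m n f ∧ q = (functionWord f : hypoplacticCon.Quotient)}

/-! A hypoplactic class is determined by its content together with its set of descents: the letters
`b` that occur before some occurrence of the preceding letter of the support. These data are
invariant because, whenever a defining relation exchanges two letters, a third letter of the
relation lies between them in value or equals one of them and keeps the descent in place.
Conversely, adjacent letters `a`, `c` commute as soon as a witness `b` occurs anywhere to their left
(`a < b ≤ c`) or to their right (`a ≤ b < c`). This is `swaps`, proved by induction on the distance
to the witness. It lets one peel off the largest letter, to the front if it is a descent and to the
back otherwise, and so reach a normal form, `quasiRibbonWord`. Any set of non-minimal letters of a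
content can be the descent set, so a content with `k` distinct letters carries `2 ^ (k - 1)`
classes. Being a parking function depends only on the content. Placing contents on a cycle of length
`m * n + 1`, the cycle lemma gives each content of total `n` exactly one parking rotation, so the
weighted sum over parking contents is the sum over all contents divided by `m * n + 1`. The latter
is computed by grouping contents by support. -/

/-- A relation on words that is compatible with concatenation and contains the defining relations of
the hypoplactic monoid. -/
structure IsHypoplactic {α : Type} [LinearOrder α] (E : List α → List α → Prop) : Prop where
  refl : ∀ u, E u u
  symm : ∀ {u v}, E u v → E v u
  trans : ∀ {u v w}, E u v → E v w → E u w
  ctx : ∀ {u v} (p q), E u v → E (p ++ u ++ q) (p ++ v ++ q)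
  knuth₁ : ∀ {a b c}, a ≤ b → b < c → E [a, c, b] [c, a, b]
  knuth₂ : ∀ {a b c}, a < b → b ≤ c → E [b, a, c] [b, c, a]
  quartic₁ : ∀ {a b c d}, a ≤ b → b < c → c ≤ d → E [c, a, d, b] [a, c, b, d]
  quartic₂ : ∀ {a b c d}, a < b → b ≤ c → c < d → E [b, d, a, c] [d, b, c, a]

/-! ### Transpositions with a distant witness -/

/-- The transposition of `a` and `c` is allowed by a witness `b` to the left, separated from them by
a word of length less than `n`. -/
def LeftSwaps {α : Type} [LinearOrder α] (E : List α → List α → Prop) (n : ℕ) : Prop :=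
  ∀ ⦃b : α⦄ ⦃p : List α⦄ ⦃a c : α⦄, p.length < n → a < b → b ≤ c →
    E (b :: (p ++ [a, c])) (b :: (p ++ [c, a]))

/-- The transposition of `a` and `c` is allowed by a witness `b` to the right, separated from them by
a word of length less than `n`. -/
def RightSwaps {α : Type} [LinearOrder α] (E : List α → List α → Prop) (n : ℕ) : Prop :=
  ∀ ⦃a c : α⦄ ⦃p : List α⦄ ⦃b : α⦄, p.length < n → a ≤ b → b < c →
    E (a :: c :: (p ++ [b])) (c :: a :: (p ++ [b]))

namespace IsHypoplactic

variable {α : Type} [LinearOrder α] {E : List α → List α → Prop}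

/-- The gap is shortened by one letter. If `y ≤ z`, then `z` witnesses moving `y` in front of `b`.
Otherwise `y` witnesses moving `z` past `a`, so that `z` can leave the gap to the right and return
after the swap. -/
theorem left_swap_of_low (H : IsHypoplactic E) {n : ℕ} (hL : LeftSwaps E n) (hR : RightSwaps E n)
    {a b c y z : α} {q : List α} (hn : q.length + 1 < n) (hab : a < b) (hbc : b ≤ c)
    (hy : y ≤ a) (hz : z ≤ a) :
    E (b :: y :: (q ++ [z, a, c])) (b :: y :: (q ++ [z, c, a])) := by
  rcases le_or_gt y z with hyz | hzy
  · have s := hR (p := q) (by omega) hyz (hz.trans_lt hab)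
    have h1 := H.ctx [] [a, c] (H.symm s)
    have h2 := H.ctx [y] [] (hL (p := q ++ [z]) (by simpa using hn) hab hbc)
    have h3 := H.ctx [] [c, a] s
    simp only [List.append_assoc, List.cons_append, List.nil_append, List.append_nil] at h1 h2 h3 ⊢
    exact H.trans h1 (H.trans h2 h3)
  · have hza := hzy.trans_le hy
    have h1 := H.ctx [b] [c] (hL (p := q) (by omega) hzy hy)
    have h2 := H.ctx (b :: y :: q) [] (H.knuth₂ hza (hab.le.trans hbc))
    have h3 := H.ctx [] [z] (hL (p := y :: q) (by simpa using hn) hab hbc)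
    have h4 := H.ctx [b] [] (H.symm (hL (p := q ++ [c]) (by simpa using hn) hzy hy))
    have h5 := H.ctx (b :: y :: q) [] (H.symm (H.knuth₁ hz (hab.trans_le hbc)))
    simp only [List.append_assoc, List.cons_append, List.nil_append, List.append_nil]
      at h1 h2 h3 h4 h5 ⊢
    exact H.trans h1 (H.trans h2 (H.trans h3 (H.trans h4 h5)))

theorem left_swap_of_high (H : IsHypoplactic E) {n : ℕ} (hL : LeftSwaps E n) (hR : RightSwaps E n)
    {a b c y z : α} {q : List α} (hn : q.length + 1 < n) (hab : a < b) (hbc : b ≤ c)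
    (hy : c < y) (hz : c < z) :
    E (b :: y :: (q ++ [z, a, c])) (b :: y :: (q ++ [z, c, a])) := by
  rcases le_or_gt y z with hyz | hzy
  · have hac := hab.trans_le hbc
    have h1 := H.ctx (b :: y :: q) [] (H.symm (H.knuth₁ hac.le hz))
    have h2 := H.ctx [b] [] (H.symm (hL (p := q ++ [a]) (by simpa using hn) hy hyz))
    have h3 := H.ctx [] [z] (hL (p := y :: q) (by simpa using hn) hab hbc)
    have h4 := H.ctx (b :: y :: q) [] (H.knuth₂ hac hz.le)
    have h5 := H.ctx [b] [a] (hL (p := q) (by omega) hy hyz)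
    simp only [List.append_assoc, List.cons_append, List.nil_append, List.append_nil]
      at h1 h2 h3 h4 h5 ⊢
    exact H.trans h1 (H.trans h2 (H.trans h3 (H.trans h4 h5)))
  · have s := hR (p := q) (by omega) (hbc.trans hz.le) hzy
    have h1 := H.ctx [] [a, c] s
    have h2 := H.ctx [y] [] (hL (p := q ++ [z]) (by simpa using hn) hab hbc)
    have h3 := H.ctx [] [c, a] (H.symm s)
    simp only [List.append_assoc, List.cons_append, List.nil_append, List.append_nil] at h1 h2 h3 ⊢
    exact H.trans h1 (H.trans h2 h3)

/-- The one gap with neither two low nor two high letters. Once `a` and `c` are exchanged, `a` is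
too far away to witness the return of `y` behind `b`, so `z` makes a detour to the front. -/
theorem left_swap_of_low_high (H : IsHypoplactic E) (hL : LeftSwaps E 2) (hR : RightSwaps E 2)
    {a b c y z : α} (hab : a < b) (hbc : b ≤ c) (hy : y ≤ a) (hz : c < z) :
    E [b, y, z, a, c] [b, y, z, c, a] := by
  have hyb := hy.trans_lt hab
  have hbz := hbc.trans_lt hz
  have h1 := H.ctx [] [c] (H.symm (hR (p := [z]) (by simp) hy hab))
  have h2 := H.ctx [y] [] (hL (p := [z]) (by simp) hab hbc)
  have h3 := H.ctx [y] [a] (H.knuth₁ hbc hz)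
  have h4 := H.ctx [] [c, a] (H.knuth₁ hyb.le hbz)
  have h5 := H.ctx [z] [] (hR (p := [c]) (by simp) hy hab)
  have h6 := H.ctx [] [a] (H.symm (hR (p := [y]) (by simp) hbc hz))
  have h7 := H.ctx [] [c, a] (H.symm (H.knuth₂ hyb hbz.le))
  simp only [List.cons_append, List.nil_append, List.append_nil] at h1 h2 h3 h4 h5 h6 h7 ⊢
  exact H.trans h1 (H.trans h2 (H.trans h3 (H.trans h4 (H.trans h5 (H.trans h6 h7)))))

/-- The base case where the quartic relations are needed; the Knuth relations alone give only an
empty gap. -/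
theorem left_swap_singleton (H : IsHypoplactic E) {a b c z : α} (hab : a < b) (hbc : b ≤ c)
    (hz : z ≤ a ∨ c < z) : E [b, z, a, c] [b, z, c, a] := by
  rcases hz with hz | hz
  · have h1 := H.ctx [] [c] (H.symm (H.knuth₁ hz hab))
    have h2 := H.symm (H.quartic₁ hz hab hbc)
    simp only [List.cons_append, List.nil_append] at h1
    exact H.trans h1 h2
  · have h1 := H.quartic₂ hab hbc hz
    have h2 := H.ctx [] [a] (H.symm (H.knuth₁ hbc hz))
    simp only [List.cons_append, List.nil_append] at h2
    exact H.trans h1 h2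

/-- Behind `b`, the letters below `b` commute with the letters above or equal to `b`. -/
theorem move_low (H : IsHypoplactic E) {n : ℕ} (hL : LeftSwaps E n) {b z : α} (hz : z < b)
    (A B : List α) (hB : ∀ x ∈ B, b ≤ x) (hn : A.length + B.length ≤ n) :
    E (b :: (A ++ B ++ [z])) (b :: (A ++ [z] ++ B)) := by
  induction B using List.reverseRecOn with
  | nil => simpa using H.refl _
  | append_singleton B x ih =>
    simp only [List.length_append, List.length_singleton] at hn
    have h1 := hL (p := A ++ B) (a := z) (c := x) (by simp; omega) hz (hB x (by simp))
    have h2 := H.ctx [] [x] (ih (fun y hy => hB y (by simp [hy])) (by omega))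
    simp only [List.append_assoc, List.cons_append, List.nil_append] at h1 h2 ⊢
    exact H.trans (H.symm h1) h2

theorem sort_low_high (H : IsHypoplactic E) {n : ℕ} (hL : LeftSwaps E n) {b : α}
    (p : List α) (hn : p.length ≤ n + 1) :
    E (b :: p) (b :: (p.filter (· < b) ++ p.filter (b ≤ ·))) := by
  induction p using List.reverseRecOn with
  | nil => simpa using H.refl _
  | append_singleton p z ih =>
    simp only [List.length_append, List.length_singleton] at hn
    have h1 := H.ctx [] [z] (ih (by omega))
    rcases lt_or_ge z b with hz | hz
    · have hlen : (p.filter (· < b)).length + (p.filter (b ≤ ·)).length ≤ p.length := by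
        rw [← List.countP_eq_length_filter, ← List.countP_eq_length_filter,
          List.length_eq_countP_add_countP (fun x => decide (x < b))]
        refine Nat.add_le_add_left (List.countP_mono_left ?_) _
        simp
      have h2 := H.move_low hL hz (p.filter (· < b)) (p.filter (b ≤ ·)) (by simp) (by omega)
      simp only [List.filter_append, List.append_assoc, List.cons_append, List.nil_append] at h1 h2 ⊢
      simpa [hz, hz.not_ge] using H.trans h1 h2
    · simpa [hz, hz.not_gt] using h1

/-- Only the subwords of letters below `b` and of letters at least `b` matter in the gap, so it may
be rearranged to have convenient end letters. -/
theorem left_swap_congr (H : IsHypoplactic E) {n : ℕ} (hL : LeftSwaps E n) {a b c : α}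
    {p p' : List α} (hp : p.length ≤ n + 1) (hp' : p'.length ≤ n + 1)
    (h₁ : p.filter (· < b) = p'.filter (· < b)) (h₂ : p.filter (b ≤ ·) = p'.filter (b ≤ ·))
    (h : E (b :: (p' ++ [a, c])) (b :: (p' ++ [c, a]))) :
    E (b :: (p ++ [a, c])) (b :: (p ++ [c, a])) := by
  have s := H.sort_low_high hL (b := b) p hp
  rw [h₁, h₂] at s
  have t := H.trans s (H.symm (H.sort_low_high hL (b := b) p' hp'))
  have h1 := H.ctx [] [a, c] t
  have h2 := H.ctx [] [c, a] (H.symm t)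
  exact H.trans (by simpa using h1) (H.trans h (by simpa using h2))

theorem _root_.List.exists_eq_cons_append_singleton {α : Type} {l : List α} (h : 2 ≤ l.length) : ∃ y q z, l = y :: (q ++ [z]) := by
  match l, h with
  | y :: x :: t, _ =>
    exact ⟨y, (x :: t).dropLast, (x :: t).getLast (by simp), by
      rw [List.dropLast_append_getLast]⟩

theorem leftSwaps_succ (H : IsHypoplactic E) {n : ℕ} (hL : LeftSwaps E n) (hR : RightSwaps E n) :
    LeftSwaps E (n + 1) := by
  intro b p a c hn hab hbc
  rcases Nat.lt_succ_iff_lt_or_eq.mp hn with hlt | hpn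
  · exact hL hlt hab hbc
  -- A gap letter in `(a, c]` is itself a closer witness. Without one, every gap letter is either at
  -- most `a` or above `c`.
  by_cases hw : ∃ x ∈ p, a < x ∧ x ≤ c
  · obtain ⟨x, hx, hax, hxc⟩ := hw
    obtain ⟨s, t, rfl⟩ := List.append_of_mem hx
    simpa using H.ctx (b :: s) [] (hL (p := t) (by simp at hpn; omega) hax hxc)
  push Not at hw
  have low : ∀ x ∈ p, x < b → x ≤ a := fun x hx hxb =>
    not_lt.mp fun h => (hw x hx h).not_ge (hxb.le.trans hbc)
  have high : ∀ x ∈ p, b ≤ x → c < x := fun x hx hxb => hw x hx (hab.trans_le hxb)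
  rcases lt_or_ge p.length 2 with hp | hp
  · match p, hp with
    | [], _ => exact H.knuth₂ hab hbc
    | [z], _ =>
      refine H.left_swap_singleton hab hbc ?_
      rcases lt_or_ge z b with h | h
      · exact Or.inl (low z (by simp) h)
      · exact Or.inr (high z (by simp) h)
  have hlen : (p.filter (· < b)).length + (p.filter (b ≤ ·)).length = p.length := by
    rw [← List.countP_eq_length_filter, ← List.countP_eq_length_filter,
      List.length_eq_countP_add_countP (fun x => decide (x < b))]
    congr 1
    exact List.countP_congr (by simp)
  have hA : ∀ x ∈ p.filter (· < b), x < b ∧ x ≤ a := fun x hx => by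
    simp only [List.mem_filter, decide_eq_true_eq] at hx
    exact ⟨hx.2, low x hx.1 hx.2⟩
  have hB : ∀ x ∈ p.filter (b ≤ ·), b ≤ x ∧ c < x := fun x hx => by
    simp only [List.mem_filter, decide_eq_true_eq] at hx
    exact ⟨hx.2, high x hx.1 hx.2⟩
  generalize hAe : p.filter (· < b) = A at *
  generalize hBe : p.filter (b ≤ ·) = B at *
  have fA : ∀ l : List α, (∀ x ∈ l, x < b ∧ x ≤ a) →
      l.filter (· < b) = l ∧ l.filter (b ≤ ·) = [] := fun l hl =>
    ⟨List.filter_eq_self.mpr fun x hx => by simp [hl x hx],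
      List.filter_eq_nil_iff.mpr fun x hx => by simp [hl x hx]⟩
  have fB : ∀ l : List α, (∀ x ∈ l, b ≤ x ∧ c < x) →
      l.filter (· < b) = [] ∧ l.filter (b ≤ ·) = l := fun l hl =>
    ⟨List.filter_eq_nil_iff.mpr fun x hx => by simp [hl x hx],
      List.filter_eq_self.mpr fun x hx => by simp [hl x hx]⟩
  -- With two low letters, or two high ones, the gap is rearranged to begin and end with letters of
  -- that kind. The only other gap of length at least two has one letter of each kind.
  rcases le_or_gt 2 A.length with h2 | h2
  · obtain ⟨y, q, z, rfl⟩ := List.exists_eq_cons_append_singleton h2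
    simp only [List.length_append, List.length_cons, List.length_nil] at hlen
    have hy := hA y (by simp)
    have hz := hA z (by simp)
    have hq := fA q fun x hx => hA x (by simp [hx])
    refine H.left_swap_congr hL (p' := y :: (q ++ B ++ [z])) (by omega) (by simp; omega) ?_ ?_ ?_
    · rw [hAe]; simp [hq, fB B hB, hy, hz]
    · rw [hBe]; simp [hq, fB B hB, hy, hz]
    · simpa using H.left_swap_of_low hL hR (q := q ++ B) (by simp; omega) hab hbc
        hy.2 hz.2
  rcases le_or_gt 2 B.length with h2' | h2'
  · obtain ⟨y, q, z, rfl⟩ := List.exists_eq_cons_append_singleton h2'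
    simp only [List.length_append, List.length_cons, List.length_nil] at hlen
    have hy := hB y (by simp)
    have hz := hB z (by simp)
    have hq := fB q fun x hx => hB x (by simp [hx])
    refine H.left_swap_congr hL (p' := y :: (A ++ q ++ [z])) (by omega) (by simp; omega) ?_ ?_ ?_
    · rw [hAe]; simp [hq, fA A hA, hy, hz]
    · rw [hBe]; simp [hq, fA A hA, hy, hz]
    · simpa using H.left_swap_of_high hL hR (q := A ++ q) (by simp; omega) hab hbc
        hy.2 hz.2
  obtain ⟨y, rfl⟩ := List.length_eq_one_iff.mp (show A.length = 1 by omega)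
  obtain ⟨z, rfl⟩ := List.length_eq_one_iff.mp (show B.length = 1 by omega)
  simp only [List.length_singleton] at hlen
  have hy := hA y (by simp)
  have hz := hB z (by simp)
  obtain rfl : n = 2 := by omega
  refine H.left_swap_congr hL (p' := [y, z]) (by omega) (by simp) ?_ ?_ ?_
  · rw [hAe]; simp [hy, hz]
  · rw [hBe]; simp [hy, hz]
  · exact H.left_swap_of_low_high hL hR hab hbc hy.2 hz.2

/-- Reversing both words and the order exchanges the two Knuth relations and fixes each quartic
relation, so right witnesses reduce to left ones. -/
theorem dual (H : IsHypoplactic E) :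
    IsHypoplactic (α := αᵒᵈ) fun u v =>
      E (u.map OrderDual.ofDual).reverse (v.map OrderDual.ofDual).reverse where
  refl u := H.refl _
  symm h := H.symm h
  trans h h' := H.trans h h'
  ctx {u v} p q h := by
    simpa using H.ctx (q.map OrderDual.ofDual).reverse (p.map OrderDual.ofDual).reverse h
  knuth₁ h h' := H.knuth₂ h' h
  knuth₂ h h' := H.knuth₁ h' h
  quartic₁ h h' h'' := H.quartic₁ h'' h' h
  quartic₂ h h' h'' := H.quartic₂ h'' h' h

theorem swaps (H : IsHypoplactic E) (n : ℕ) : LeftSwaps E n ∧ RightSwaps E n := by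
  induction n with
  | zero => exact ⟨fun _ _ _ _ h => absurd h (by simp), fun _ _ _ _ h => absurd h (by simp)⟩
  | succ n ih =>
    obtain ⟨hL, hR⟩ := ih
    refine ⟨H.leftSwaps_succ hL hR, ?_⟩
    have key := H.dual.leftSwaps_succ (n := n)
      (fun b p a c hn hab hbc => by
        have := hR (a := OrderDual.ofDual c) (b := OrderDual.ofDual b) (c := OrderDual.ofDual a)
          (p := (p.map OrderDual.ofDual).reverse) (by simpa using hn) hbc hab
        simpa using this)
      (fun a c p b hn hab hbc => by
        have := hL (a := OrderDual.ofDual c) (b := OrderDual.ofDual b) (c := OrderDual.ofDual a)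
          (p := (p.map OrderDual.ofDual).reverse) (by simpa using hn) hbc hab
        simpa using this)
    intro a c p b hn hab hbc
    have := key (b := OrderDual.toDual b) (p := (p.map OrderDual.toDual).reverse)
      (a := OrderDual.toDual c) (c := OrderDual.toDual a) (by simpa using hn) hbc hab
    simpa [Function.comp_def] using this

theorem swap_of_right (H : IsHypoplactic E) {a b c : α} {p q : List α} (hb : b ∈ q)
    (hab : a ≤ b) (hbc : b < c) : E (p ++ a :: c :: q) (p ++ c :: a :: q) := by
  obtain ⟨s, t, rfl⟩ := List.append_of_mem hb
  simpa using H.ctx p t ((H.swaps (s.length + 1)).2 (p := s) (by simp) hab hbc)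

end IsHypoplactic

/-! ### Peeling off the largest letter -/

namespace IsHypoplactic

variable {α : Type} [LinearOrder α] {E : List α → List α → Prop}

/-- Behind `b`, the letters below `b` commute with the letters above or equal to `b`. -/
theorem congr_behind (H : IsHypoplactic E) {b : α} {p p' : List α}
    (h₁ : p.filter (· < b) = p'.filter (· < b)) (h₂ : p.filter (b ≤ ·) = p'.filter (b ≤ ·)) :
    E (b :: p) (b :: p') := by
  have s := H.sort_low_high (H.swaps p.length).1 (b := b) p (by omega)
  rw [h₁, h₂] at s
  exact H.trans s (H.symm (H.sort_low_high (H.swaps p'.length).1 (b := b) p' (by omega)))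

theorem move_max_left (H : IsHypoplactic E) {M N : α} {p q : List α} (hp : ∀ x ∈ p, x ≤ N)
    (hNM : N < M) (hq : N ∈ q) : E (p ++ M :: q) (M :: (p ++ q)) := by
  induction p using List.reverseRecOn generalizing q with
  | nil => exact H.refl _
  | append_singleton p x ih =>
    have h1 := H.swap_of_right (p := p) hq (hp x (by simp)) hNM
    have h2 := ih (q := x :: q) (fun y hy => hp y (by simp [hy])) (by simp [hq])
    simpa using H.trans h1 (by simpa using h2)

end IsHypoplactic

/-- The letter `b` of `w` occurs somewhere before an occurrence of the preceding letter of the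
support of `w`. -/
def List.Descent {α : Type} [LinearOrder α] (w : List α) (b : α) : Prop :=
  ∃ a < b, [b, a].Sublist w ∧ ∀ x ∈ w, x ≤ a ∨ b ≤ x

theorem List.pair_sublist_append {α : Type} {a b : α} {u v : List α} :
    [b, a].Sublist (u ++ v) ↔ [b, a].Sublist u ∨ [b, a].Sublist v ∨ (b ∈ u ∧ a ∈ v) := by
  induction u with
  | nil => simp
  | cons x u ih =>
    rw [List.cons_append, List.sublist_cons_iff, List.sublist_cons_iff, ih]
    simp only [List.cons.injEq, List.mem_cons]
    constructor
    · rintro ((h | h | h) | ⟨r, ⟨rfl, rfl⟩, h⟩)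
      · tauto
      · tauto
      · tauto
      · simp only [List.singleton_sublist, List.mem_append] at h
        rcases h with h | h
        · exact Or.inl (Or.inr ⟨_, ⟨rfl, rfl⟩, by simpa using h⟩)
        · tauto
    · rintro ((h | ⟨r, ⟨rfl, rfl⟩, h⟩) | h | ⟨rfl | h, h'⟩)
      · tauto
      · simp only [List.singleton_sublist] at h
        exact Or.inr ⟨_, ⟨rfl, rfl⟩, by simp [h]⟩
      · tauto
      · exact Or.inr ⟨_, ⟨rfl, rfl⟩, by simp [h']⟩
      · tauto

namespace IsHypoplactic

variable {α : Type} [LinearOrder α] {E : List α → List α → Prop}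

/-- An occurrence of the predecessor `N` after the first `M` witnesses moving that `M` to the front;
from there it witnesses the extraction of all other copies of `M`. -/
theorem of_descent_max (H : IsHypoplactic E) {w : List α} {M : α} (hw : ∀ x ∈ w, x ≤ M)
    (hd : w.Descent M) : E w (w.filter (M ≤ ·) ++ w.filter (· < M)) := by
  obtain ⟨N, hNM, hsub, hgap⟩ := hd
  obtain ⟨p, q, rfl, hMp⟩ := List.eq_append_cons_of_mem (hsub.subset (by simp : M ∈ [M, N]))
  have hp : ∀ x ∈ p, x ≤ N := fun x hx => (hgap x (by simp [hx])).resolve_right fun h =>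
    hMp ((hw x (by simp [hx])).antisymm h ▸ hx)
  have hNq : N ∈ q := by
    rcases List.pair_sublist_append.mp hsub with h | h | h
    · exact absurd (h.subset (by simp)) hMp
    · simpa using h
    · exact absurd h.1 hMp
  have h1 : p.filter (· < M) = p :=
    List.filter_eq_self.mpr fun x hx => by simpa using (hp x hx).trans_lt hNM
  have h2 : p.filter (M ≤ ·) = [] :=
    List.filter_eq_nil_iff.mpr fun x hx => by simpa using (hp x hx).trans_lt hNM
  have h3 : E (M :: (p ++ q)) (M :: (q.filter (M ≤ ·) ++ (p ++ q.filter (· < M)))) := by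
    have h4 : ∀ l : List α, (l.filter (M ≤ ·)).filter (· < M) = [] := fun l =>
      List.filter_eq_nil_iff.mpr fun x hx => by simpa using (List.mem_filter.mp hx).2
    have h5 : ∀ l : List α, (l.filter (· < M)).filter (M ≤ ·) = [] := fun l =>
      List.filter_eq_nil_iff.mpr fun x hx => by simpa using (List.mem_filter.mp hx).2
    have h6 : ∀ l : List α, (l.filter (· < M)).filter (· < M) = l.filter (· < M) := fun l =>
      List.filter_eq_self.mpr fun x hx => (List.mem_filter.mp hx).2
    have h7 : ∀ l : List α, (l.filter (M ≤ ·)).filter (M ≤ ·) = l.filter (M ≤ ·) := fun l =>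
      List.filter_eq_self.mpr fun x hx => (List.mem_filter.mp hx).2
    refine H.congr_behind ?_ ?_ <;>
      simp only [List.filter_append, h1, h2, h4, h5, h6, h7, List.nil_append, List.append_nil]
  simpa [h1, h2] using H.trans (H.move_max_left hp hNM hNq) h3

/-- Every `M` lies after the last occurrence of the predecessor `N`. Behind that `N` the remaining
letters are below `N` or equal to `M`, and these two kinds commute. -/
theorem of_not_descent_max (H : IsHypoplactic E) {w : List α} {M : α} (hw : ∀ x ∈ w, x ≤ M)
    (hd : ¬ w.Descent M) : E w (w.filter (· < M) ++ w.filter (M ≤ ·)) := by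
  rcases (w.filter (· < M)).toFinset.eq_empty_or_nonempty with he | hne
  · rw [List.toFinset_eq_empty_iff] at he
    have : w.filter (M ≤ ·) = w := List.filter_eq_self.mpr fun x hx => by
      simpa using List.filter_eq_nil_iff.mp he x hx
    rw [he, this]
    exact H.refl _
  obtain ⟨N, hN, hmax⟩ := Finset.exists_max_image _ id hne
  simp only [List.mem_toFinset, List.mem_filter, decide_eq_true_eq, id] at hN hmax
  have hgap : ∀ x ∈ w, x ≤ N ∨ M ≤ x := fun x hx =>
    (lt_or_ge x M).imp (fun h => hmax x ⟨hx, h⟩) id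
  have hsub : ¬ [M, N].Sublist w := fun h => hd ⟨N, hN.2, h, hgap⟩
  have hNr := List.mem_reverse.mpr hN.1
  obtain ⟨q, p, hr, hNq⟩ := List.eq_append_cons_of_mem hNr
  obtain rfl : w = p.reverse ++ N :: q.reverse := by
    rw [← List.reverse_inj, hr]; simp
  generalize p.reverse = p' at *
  have hNq : N ∉ q.reverse := by simpa using hNq
  generalize q.reverse = q' at *
  have hMp : ∀ x ∈ p', x < M := fun x hx => (hw x (by simp [hx])).lt_of_ne fun h =>
    hsub (List.pair_sublist_append.mpr (Or.inr (Or.inr ⟨h ▸ hx, by simp⟩)))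
  have h1 : p'.filter (· < M) = p' := List.filter_eq_self.mpr (by simpa using hMp)
  have h2 : p'.filter (M ≤ ·) = [] := List.filter_eq_nil_iff.mpr (by simpa using hMp)
  have hq : ∀ x ∈ q', (x < M ↔ x < N) ∧ (M ≤ x ↔ N ≤ x) := fun x hx => by
    rcases hgap x (by simp [hx]) with h | h
    · have := h.lt_of_ne fun e => hNq (e ▸ hx)
      simp [this, this.trans hN.2, this.not_ge, (this.trans hN.2).not_ge]
    · simp [h, hN.2.le.trans h, h.not_gt, (hN.2.le.trans h).not_gt]
  have key := H.sort_low_high (H.swaps q'.length).1 (b := N) q' (by omega)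
  have e1 : q'.filter (· < M) = q'.filter (· < N) :=
    List.filter_congr fun x hx => by simp only [(hq x hx).1]
  have e2 : q'.filter (M ≤ ·) = q'.filter (N ≤ ·) :=
    List.filter_congr fun x hx => by simp only [(hq x hx).2]
  rw [← e1, ← e2] at key
  simpa [h1, h2, hN.2, hN.2.not_ge] using H.ctx p' [] key

end IsHypoplactic

theorem List.descent_filter_lt {α : Type} [LinearOrder α] {w : List α} {b M : α} (hb : b < M) :
    (w.filter (· < M)).Descent b ↔ w.Descent b := by
  constructor
  · rintro ⟨a, hab, hs, hg⟩
    refine ⟨a, hab, hs.trans List.filter_sublist, fun x hx => ?_⟩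
    rcases lt_or_ge x M with h | h
    · exact hg x (by simp [hx, h])
    · exact Or.inr (hb.le.trans h)
  · rintro ⟨a, hab, hs, hg⟩
    refine ⟨a, hab, ?_, fun x hx => hg x (List.mem_of_mem_filter hx)⟩
    simpa [hb, hab.trans hb] using hs.filter (· < M)

/-! ### Quasi-ribbon normal forms -/

open Classical in
/-- The quasi-ribbon word with letters below a bound, given multiplicities and given descents. -/
noncomputable def quasiRibbonWord (cnt : ℕ → ℕ) (D : ℕ → Prop) : ℕ → List ℕ
  | 0 => []
  | M + 1 => if D M then List.replicate (cnt M) M ++ quasiRibbonWord cnt D M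
      else quasiRibbonWord cnt D M ++ List.replicate (cnt M) M

theorem count_quasiRibbonWord (cnt : ℕ → ℕ) (D : ℕ → Prop) (M b : ℕ) :
    (quasiRibbonWord cnt D M).count b = if b < M then cnt b else 0 := by
  induction M with
  | zero => simp [quasiRibbonWord]
  | succ M ih =>
    rw [quasiRibbonWord]
    split_ifs <;> simp [ih, List.count_replicate] <;> grind

theorem lt_of_mem_quasiRibbonWord {cnt : ℕ → ℕ} {D : ℕ → Prop} {M b : ℕ}
    (h : b ∈ quasiRibbonWord cnt D M) : b < M ∧ 0 < cnt b := by
  have := List.count_pos_iff.mpr h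
  rw [count_quasiRibbonWord] at this
  split_ifs at this with hb
  · exact ⟨hb, this⟩
  · simp at this

theorem quasiRibbonWord_congr {cnt cnt' : ℕ → ℕ} {D D' : ℕ → Prop} {M : ℕ}
    (h : ∀ b < M, cnt b = cnt' b ∧ (D b ↔ D' b)) :
    quasiRibbonWord cnt D M = quasiRibbonWord cnt' D' M := by
  induction M with
  | zero => rfl
  | succ M ih =>
    obtain ⟨hc, hD⟩ := h M (by omega)
    by_cases hM : D M
    · rw [quasiRibbonWord, quasiRibbonWord, if_pos hM, if_pos (hD.mp hM), hc,
        ih fun b hb => h b (by omega)]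
    · rw [quasiRibbonWord, quasiRibbonWord, if_neg hM, if_neg (mt hD.mpr hM), hc,
        ih fun b hb => h b (by omega)]

theorem filter_lt_quasiRibbonWord (cnt : ℕ → ℕ) (D : ℕ → Prop) (M : ℕ) :
    (quasiRibbonWord cnt D (M + 1)).filter (· < M) = quasiRibbonWord cnt D M := by
  have : (quasiRibbonWord cnt D M).filter (· < M) = quasiRibbonWord cnt D M :=
    List.filter_eq_self.mpr fun x hx => by simpa using (lt_of_mem_quasiRibbonWord hx).1
  rw [quasiRibbonWord]
  split_ifs <;> simp [this]

/-- The block of `b` precedes all smaller letters exactly when `D b` holds; the hypothesis on `D`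
provides both a copy of `b` and a predecessor, without which no descent exists. -/
theorem descent_quasiRibbonWord {cnt : ℕ → ℕ} {D : ℕ → Prop}
    (hD : ∀ b, D b → 0 < cnt b ∧ ∃ a < b, 0 < cnt a) {M b : ℕ} (hb : b < M) :
    (quasiRibbonWord cnt D M).Descent b ↔ D b := by
  induction M with
  | zero => omega
  | succ M ih =>
    rcases Nat.lt_succ_iff_lt_or_eq.mp hb with hlt | rfl
    · rw [← List.descent_filter_lt hlt, filter_lt_quasiRibbonWord, ih hlt]
    · constructor
      · rintro ⟨a, hab, hs, -⟩
        by_contra hDb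
        rw [quasiRibbonWord, if_neg hDb, List.pair_sublist_append] at hs
        rcases hs with hs | hs | ⟨hs, -⟩
        · exact (lt_of_mem_quasiRibbonWord (hs.subset (by simp : b ∈ [b, a]))).1.ne rfl
        · exact hab.ne (List.eq_of_mem_replicate (hs.subset (by simp : a ∈ [b, a])))
        · exact (lt_of_mem_quasiRibbonWord hs).1.ne rfl
      · intro hDb
        obtain ⟨hcb, a₀, ha₀, hca₀⟩ := hD b hDb
        have hmem : a₀ ∈ (quasiRibbonWord cnt D b).toFinset := by
          rw [List.mem_toFinset, ← List.count_pos_iff, count_quasiRibbonWord, if_pos ha₀]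
          exact hca₀
        obtain ⟨a, ha, hmax⟩ := Finset.exists_max_image _ id ⟨a₀, hmem⟩
        rw [List.mem_toFinset] at ha
        rw [quasiRibbonWord, if_pos hDb]
        refine ⟨a, (lt_of_mem_quasiRibbonWord ha).1, List.pair_sublist_append.mpr
          (Or.inr (Or.inr ⟨by simp [hcb.ne'], ha⟩)), fun x hx => ?_⟩
        rcases List.mem_append.mp hx with hx | hx
        · exact Or.inr (List.eq_of_mem_replicate hx).ge
        · exact Or.inl (hmax x (by simpa using hx))

namespace IsHypoplactic

theorem quasiRibbonWord {E : List ℕ → List ℕ → Prop} (H : IsHypoplactic E) {M : ℕ} {w : List ℕ}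
    (hw : ∀ x ∈ w, x < M) : E w (quasiRibbonWord (fun b => w.count b) w.Descent M) := by
  induction M generalizing w with
  | zero =>
    rw [List.eq_nil_iff_forall_not_mem.mpr fun x hx => absurd (hw x hx) (by simp)]
    exact H.refl _
  | succ M ih =>
    have h1 := ih (w := w.filter (· < M)) (by simp)
    have hcongr : _root_.quasiRibbonWord (fun b => (w.filter (· < M)).count b)
        (w.filter (· < M)).Descent M = _root_.quasiRibbonWord (fun b => w.count b) w.Descent M :=
      quasiRibbonWord_congr fun b hb =>
        ⟨List.count_filter (by simpa using hb), List.descent_filter_lt hb⟩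
    have hrep : w.filter (M ≤ ·) = List.replicate (w.count M) M := by
      rw [← List.filter_eq]
      refine List.filter_congr fun x hx => ?_
      have := hw x hx
      simp; omega
    rw [hcongr] at h1
    rw [_root_.quasiRibbonWord]
    split_ifs with hd
    · have h2 := H.of_descent_max (fun x hx => Nat.le_of_lt_succ (hw x hx)) hd
      rw [hrep] at h2
      simpa using H.trans h2 (by simpa using H.ctx (List.replicate (w.count M) M) [] h1)
    · have h2 := H.of_not_descent_max (fun x hx => Nat.le_of_lt_succ (hw x hx)) hd
      rw [hrep] at h2
      simpa using H.trans h2 (by simpa using H.ctx [] (List.replicate (w.count M) M) h1)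

end IsHypoplactic

/-! ### Content and descents as invariants -/

/-- Two words are related if they have the same content and the same descents. -/
def descentCon : Con (FreeMonoid ℕ) where
  r u v := u.toList.Perm v.toList ∧ ∀ a b, a < b → (∀ x ∈ u.toList, x ≤ a ∨ b ≤ x) →
    ([b, a].Sublist u.toList ↔ [b, a].Sublist v.toList)
  iseqv :=
    { refl := fun u => ⟨List.Perm.refl _, fun _ _ _ _ => Iff.rfl⟩
      symm := fun h => ⟨h.1.symm, fun a b hab hg =>
        (h.2 a b hab fun x hx => hg x (h.1.subset hx)).symm⟩
      trans := fun h h' => ⟨h.1.trans h'.1, fun a b hab hg =>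
        (h.2 a b hab hg).trans (h'.2 a b hab fun x hx => hg x (h.1.symm.subset hx))⟩ }
  mul' := fun {u v u' v'} h h' => by
    -- A pair with no letter of the product strictly between has none in either factor, even if a
    -- factor lacks `a` or `b`. A subword `b a` straddling the cut depends only on the contents.
    refine ⟨by simpa using h.1.append h'.1, fun a b hab hg => ?_⟩
    simp only [FreeMonoid.toList_mul, List.mem_append] at hg ⊢
    rw [List.pair_sublist_append, List.pair_sublist_append,
      h.2 a b hab fun x hx => hg x (Or.inl hx), h'.2 a b hab fun x hx => hg x (Or.inr hx),
      h.1.mem_iff, h'.1.mem_iff]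

theorem List.pair_sublist_cons {α : Type} {a b x : α} {l : List α} :
    [b, a].Sublist (x :: l) ↔ [b, a].Sublist l ∨ (b = x ∧ a ∈ l) := by
  rw [List.sublist_cons_iff]
  simp

theorem hypoplacticCon_le_descentCon : hypoplacticCon ≤ descentCon := by
  refine Con.conGen_le.mpr ?_
  intro u v h
  cases h
  case knuth₁ a b c hab hbc =>
    refine ⟨List.Perm.swap _ _ _, fun x y hxy hg => ?_⟩
    simp only [FreeMonoid.toList_ofList, List.mem_cons, List.not_mem_nil, or_false,
      List.pair_sublist_cons, forall_eq_or_imp, forall_eq, and_false, List.sublist_nil,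
      reduceCtorEq, false_or] at hg ⊢
    omega
  case knuth₂ a b c hab hbc =>
    refine ⟨(List.Perm.swap _ _ _).cons _, fun x y hxy hg => ?_⟩
    simp only [FreeMonoid.toList_ofList, List.mem_cons, List.not_mem_nil, or_false,
      List.pair_sublist_cons, forall_eq_or_imp, forall_eq, and_false, List.sublist_nil,
      reduceCtorEq, false_or] at hg ⊢
    omega
  case quartic₁ a b c d hab hbc hcd =>
    refine ⟨(List.Perm.swap _ _ _).trans (((List.Perm.swap _ _ _).cons _).cons _),
      fun x y hxy hg => ?_⟩
    simp only [FreeMonoid.toList_ofList, List.mem_cons, List.not_mem_nil, or_false,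
      List.pair_sublist_cons, forall_eq_or_imp, forall_eq, and_false, List.sublist_nil,
      reduceCtorEq, false_or] at hg ⊢
    omega
  case quartic₂ a b c d hab hbc hcd =>
    refine ⟨(List.Perm.swap _ _ _).trans (((List.Perm.swap _ _ _).cons _).cons _),
      fun x y hxy hg => ?_⟩
    simp only [FreeMonoid.toList_ofList, List.mem_cons, List.not_mem_nil, or_false,
      List.pair_sublist_cons, forall_eq_or_imp, forall_eq, and_false, List.sublist_nil,
      reduceCtorEq, false_or] at hg ⊢
    omega

theorem List.Descent.of_descentCon {u v : FreeMonoid ℕ} (h : descentCon u v) {b : ℕ}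
    (hd : u.toList.Descent b) : v.toList.Descent b := by
  obtain ⟨a, hab, hs, hg⟩ := hd
  exact ⟨a, hab, (h.2 a b hab hg).mp hs, fun x hx => hg x (h.1.symm.subset hx)⟩

theorem isHypoplactic_hypoplacticCon : IsHypoplactic fun u v : List ℕ =>
    hypoplacticCon (FreeMonoid.ofList u) (FreeMonoid.ofList v) where
  refl u := hypoplacticCon.refl _
  symm h := hypoplacticCon.symm h
  trans h h' := hypoplacticCon.trans h h'
  ctx p q h := by
    simpa only [FreeMonoid.ofList_append] using
      hypoplacticCon.mul (hypoplacticCon.mul (hypoplacticCon.refl _) h) (hypoplacticCon.refl _)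
  knuth₁ h h' := Con.le_conGen _ _ (.knuth₁ _ _ _ h h')
  knuth₂ h h' := Con.le_conGen _ _ (.knuth₂ _ _ _ h h')
  quartic₁ h h' h'' := Con.le_conGen _ _ (.quartic₁ _ _ _ _ h h' h'')
  quartic₂ h h' h'' := Con.le_conGen _ _ (.quartic₂ _ _ _ _ h h' h'')

theorem hypoplacticCon_quasiRibbonWord {M : ℕ} {w : List ℕ} (hw : ∀ x ∈ w, x < M) :
    hypoplacticCon (FreeMonoid.ofList w)
      (FreeMonoid.ofList (quasiRibbonWord (fun b => w.count b) w.Descent M)) :=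
  isHypoplactic_hypoplacticCon.quasiRibbonWord hw

theorem count_eq_and_descent_iff_of_hypoplacticCon {u v : List ℕ}
    (h : hypoplacticCon (FreeMonoid.ofList u) (FreeMonoid.ofList v)) (b : ℕ) :
    u.count b = v.count b ∧ (u.Descent b ↔ v.Descent b) := by
  have h' := hypoplacticCon_le_descentCon h
  exact ⟨h'.1.count_eq b, List.Descent.of_descentCon h',
    List.Descent.of_descentCon (descentCon.symm h')⟩

/-! ### Contents grouped by support -/

open Finset in
-- With `k` the size of `A`, these are compositions of `n` into `k` positive parts, and `n * (n -
-- 1).choose (k - 1) = k * n.choose k`. The multiplied form also covers `k = 0`.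
theorem mul_card_piAntidiag_filter_support {ι : Type} [Fintype ι] [DecidableEq ι] (A : Finset ι)
    {n : ℕ} (hn : 1 ≤ n) :
    n * #{c ∈ piAntidiag (univ : Finset ι) n | ({i | c i ≠ 0} : Finset ι) = A} =
      #A * n.choose #A := by
  rcases lt_or_ge n #A with h | h
  · rw [Nat.choose_eq_zero_of_lt h, mul_zero, Finset.card_eq_zero.mpr, mul_zero]
    refine Finset.filter_eq_empty_iff.mpr fun c hc hA => h.not_ge ?_
    rw [mem_piAntidiag] at hc
    rw [← hc.1, Finset.card_eq_sum_ones]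
    calc ∑ i ∈ A, 1 ≤ ∑ i ∈ A, c i := Finset.sum_le_sum fun i hi => by
            rw [← hA] at hi
            simp at hi
            omega
      _ ≤ ∑ i, c i := Finset.sum_le_sum_of_subset (subset_univ _)
  have hcard : #{c ∈ piAntidiag (univ : Finset ι) n | ({i | c i ≠ 0} : Finset ι) = A} =
      #(A.finsuppAntidiag (n - #A)) := by
    symm
    refine Finset.card_bij (fun f _ i => if i ∈ A then f i + 1 else 0) ?_ ?_ ?_
    · intro f hf
      rw [mem_finsuppAntidiag] at hf
      simp only [mem_filter, mem_piAntidiag, mem_univ, implies_true, and_true]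
      refine ⟨?_, by ext i; simp⟩
      rw [Finset.sum_ite_mem, univ_inter, Finset.sum_add_distrib, hf.1]
      simp
      omega
    · intro f hf g hg hfg
      rw [mem_finsuppAntidiag] at hf hg
      ext i
      by_cases hi : i ∈ A
      · simpa [hi] using congr_fun hfg i
      · rw [Finsupp.notMem_support_iff.mp fun h => hi (hf.2 h),
          Finsupp.notMem_support_iff.mp fun h => hi (hg.2 h)]
    · intro c hc
      simp only [mem_filter, mem_piAntidiag, mem_univ, implies_true, and_true] at hc
      obtain ⟨hsum, rfl⟩ := hc
      refine ⟨Finsupp.equivFunOnFinite.symm fun i => c i - 1, ?_, ?_⟩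
      · rw [mem_finsuppAntidiag]
        constructor
        · have : ∑ i ∈ ({i | c i ≠ 0} : Finset ι), (c i - 1 + 1) = n := by
            rw [← hsum, ← Finset.sum_filter_ne_zero univ]
            refine Finset.sum_congr rfl fun i hi => ?_
            simp at hi
            omega
          rw [Finset.sum_add_distrib, Finset.sum_const, smul_eq_mul, mul_one] at this
          change ∑ i ∈ ({i | c i ≠ 0} : Finset ι), (c i - 1) = _
          omega
        · intro i hi
          simp at hi ⊢
          omega
      · ext i
        by_cases hi : c i = 0
        · simp [hi]
        · simp [hi]
          omega
  rw [hcard, card_finsuppAntidiag_nat_eq_choose, Nat.add_sub_cancel' h]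
  rcases Nat.eq_zero_or_pos #A with h0 | h0
  · rw [h0, Nat.sub_zero, Nat.choose_eq_zero_of_lt (by omega)]
    simp
  · obtain ⟨k, hk⟩ := Nat.exists_eq_add_of_lt h0
    obtain ⟨n, rfl⟩ := Nat.exists_eq_add_of_le' hn
    have hk : #A = k + 1 := by omega
    rw [hk] at h ⊢
    rw [show n + 1 - 1 = n by omega, show n + 1 - (k + 1) = n - k by omega,
      Nat.choose_symm (by omega), Nat.add_one_mul_choose_eq]
    ring

open Finset in
theorem mul_sum_two_pow_piAntidiag {n : ℕ} (N : ℕ) (ι : Type) [Fintype ι] [DecidableEq ι]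
    (hι : Fintype.card ι = N + 1) (hn : 1 ≤ n) (hN : n ≤ N) :
    n * ∑ c ∈ piAntidiag (univ : Finset ι) n, 2 ^ (#{i | c i ≠ 0} - 1) =
      (N + 1) * ∑ k ∈ Icc 1 n, N.choose (k - 1) * n.choose k * 2 ^ (k - 1) := by
  have h1 : ∑ c ∈ piAntidiag (univ : Finset ι) n, 2 ^ (#{i | c i ≠ 0} - 1) =
      ∑ A ∈ (univ : Finset ι).powerset,
        #{c ∈ piAntidiag (univ : Finset ι) n | ({i | c i ≠ 0} : Finset ι) = A} * 2 ^ (#A - 1) := by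
    rw [← Finset.sum_fiberwise_of_maps_to (t := (univ : Finset ι).powerset)
      (g := fun c : ι → ℕ => ({i | c i ≠ 0} : Finset ι)) (by simp)]
    refine Finset.sum_congr rfl fun A _ => ?_
    rw [← smul_eq_mul, ← Finset.sum_const]
    refine Finset.sum_congr rfl fun c hc => ?_
    rw [(mem_filter.mp hc).2]
  rw [h1, Finset.mul_sum]
  simp only [← mul_assoc, mul_card_piAntidiag_filter_support _ hn]
  rw [Finset.sum_powerset_apply_card (fun k => k * n.choose k * 2 ^ (k - 1)), card_univ, hι,
    Finset.mul_sum]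
  have hsub : Icc 1 n ⊆ range (N + 1 + 1) := fun k hk => by
    simp at hk ⊢
    omega
  rw [← Finset.sum_subset hsub]
  · refine Finset.sum_congr rfl fun k hk => ?_
    obtain ⟨k, rfl⟩ := Nat.exists_eq_add_of_le' (mem_Icc.mp hk).1
    have := Nat.add_one_mul_choose_eq N k
    rw [show k + 1 - 1 = k by omega, smul_eq_mul]
    calc (N + 1).choose (k + 1) * ((k + 1) * n.choose (k + 1) * 2 ^ k)
        = (N + 1).choose (k + 1) * (k + 1) * (n.choose (k + 1) * 2 ^ k) := by ring
      _ = (N + 1) * (N.choose k * n.choose (k + 1) * 2 ^ k) := by rw [← this]; ring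
  · intro k _ hk
    rw [mem_Icc, not_and_or] at hk
    rcases hk with hk | hk
    · obtain rfl : k = 0 := by omega
      simp
    · rw [Nat.choose_eq_zero_of_lt (n := n) (by omega)]
      simp

/-! ### The cycle lemma and parking contents -/

/-- The cycle lemma for integer walks that decrease by one over a period. -/
theorem existsUnique_cycle_min {L : ℕ} (hL : 0 < L) {S : ℕ → ℤ} (hS : ∀ t, S (t + L) = S t - 1) :
    ∃! r, r < L ∧ ∀ t < L, S r ≤ S (r + t) := by
  obtain ⟨r₀, hr₀, hmin⟩ := Finset.exists_min_image (Finset.range L) S ⟨0, by simpa⟩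
  have hex : ∃ r, r < L ∧ ∀ t < L, S r ≤ S t :=
    ⟨r₀, by simpa using hr₀, fun t ht => hmin t (by simpa)⟩
  classical
  have hr := Nat.find_spec hex
  -- The first minimiser in a period is strictly below everything before it, which absorbs the drop
  -- by one in the next period.
  have hlt : ∀ t < Nat.find hex, S (Nat.find hex) < S t := fun t ht => by
    by_contra hle
    exact Nat.find_min hex ht ⟨ht.trans hr.1, fun s hs => (not_lt.mp hle).trans (hr.2 s hs)⟩
  generalize Nat.find hex = r at hr hlt
  have hgood : ∀ t < L, S r ≤ S (r + t) := fun t ht => by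
    rcases lt_or_ge (r + t) L with h | h
    · exact hr.2 _ h
    · have h1 := hS (r + t - L)
      have h2 := hlt (r + t - L) (by omega)
      rw [Nat.sub_add_cancel h] at h1
      omega
  -- Two good starting points would give `S r ≤ S r' ≤ S (r + L) = S r - 1`.
  have key : ∀ r r', r < r' → r' < L → (∀ t < L, S r ≤ S (r + t)) →
      ¬ ∀ t < L, S r' ≤ S (r' + t) := fun r r' h h' h1 h2 => by
    have h3 := h1 (r' - r) (by omega)
    have h4 := h2 (r + L - r') (by omega)
    rw [show r + (r' - r) = r' by omega] at h3
    rw [show r' + (r + L - r') = r + L by omega, hS] at h4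
    omega
  refine ⟨r, ⟨hr.1, hgood⟩, ?_⟩
  rintro r' ⟨hr', h'⟩
  rcases lt_trichotomy r' r with h | h | h
  · exact absurd hgood (key r' r h hr.1 h')
  · exact h
  · exact absurd h' (key r r' h hr' hgood)

theorem ZMod.sum_range_natCast {L : ℕ} [NeZero L] (c : ZMod L → ℕ) :
    ∑ j ∈ Finset.range L, c j = ∑ i, c i := by
  refine Finset.sum_bij (fun j _ => (j : ZMod L)) (by simp) ?_ ?_ (by simp)
  · intro i hi j hj h
    rw [Finset.mem_range] at hi hj
    simpa [Nat.ModEq, Nat.mod_eq_of_lt hi, Nat.mod_eq_of_lt hj] using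
      (ZMod.natCast_eq_natCast_iff i j L).mp h
  · exact fun i _ => ⟨i.val, by simpa using ZMod.val_lt i, by simp⟩

open Finset in
/-- The contents of `m`-parking functions of size `n`, where `c i` is the number of occurrences of
the value `i + 1`. -/
def parkingContents (m n : ℕ) : Finset (ZMod (m * n + 1) → ℕ) :=
  {c ∈ piAntidiag univ n | ∀ t < m * n + 1, t ≤ m * ∑ j ∈ range t, c j}

open Finset in
-- The walk `m * ∑ j < t, c j - t` changes by `m * n - (m * n + 1) = -1` over a period, and the
-- rotation by `r` is parking exactly when the walk stays at or above its value at `r` for one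
-- period.
theorem existsUnique_rotation_mem_parkingContents {m n : ℕ} {c : ZMod (m * n + 1) → ℕ}
    (hc : ∑ i, c i = n) : ∃! r, (fun i => c (i + r)) ∈ parkingContents m n := by
  have hperiod : ∀ t, ∑ j ∈ range (t + (m * n + 1)), c j = ∑ j ∈ range t, c j + n := fun t => by
    induction t with
    | zero => rw [zero_add, ZMod.sum_range_natCast, hc]; simp
    | succ t ih =>
      rw [show t + 1 + (m * n + 1) = t + (m * n + 1) + 1 by omega, sum_range_succ, ih, sum_range_succ]
      simp
      omega
  have hmem : ∀ r : ZMod (m * n + 1), (fun i => c (i + r)) ∈ parkingContents m n ↔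
      ∀ t < m * n + 1, (m * ∑ j ∈ range r.val, c j : ℤ) - r.val ≤
        m * ∑ j ∈ range (r.val + t), c j - (r.val + t : ℕ) := fun r => by
    have h1 : ∑ i, c (i + r) = n :=
      (Fintype.sum_equiv (Equiv.addRight r) _ _ (by simp)).trans hc
    simp only [parkingContents, mem_filter, mem_piAntidiag, mem_univ, implies_true, and_true, h1,
      true_and]
    refine forall₂_congr fun t _ => ?_
    rw [sum_range_add]
    have h2 : ∀ j : ℕ, ((r.val + j : ℕ) : ZMod (m * n + 1)) = j + r := fun j => by
      rw [Nat.cast_add, ZMod.natCast_zmod_val]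
      exact add_comm _ _
    simp only [h2]
    zify
    constructor <;> intro h <;> linarith
  obtain ⟨r, ⟨hr, hr'⟩, huniq⟩ := existsUnique_cycle_min (L := m * n + 1) (by omega)
    (S := fun t => (m * ∑ j ∈ range t, c j : ℤ) - t) (fun t => by
      rw [hperiod t]
      push_cast
      ring)
  refine ⟨(r : ZMod (m * n + 1)), (hmem _).mpr ?_, fun s hs => ?_⟩
  · rw [ZMod.val_natCast_of_lt hr]
    exact hr'
  · rw [← huniq s.val ⟨ZMod.val_lt s, (hmem s).mp hs⟩]
    simp

open Finset in
-- Double counting of pairs of a content and a rotation making it parking: rotation preserves the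
-- size of the support.
theorem sum_two_pow_parkingContents (m n : ℕ) :
    (m * n + 1) * ∑ c ∈ parkingContents m n, 2 ^ (#{i | c i ≠ 0} - 1) =
      ∑ c ∈ piAntidiag (univ : Finset (ZMod (m * n + 1))) n, 2 ^ (#{i | c i ≠ 0} - 1) := by
  have h1 : ∀ c ∈ piAntidiag (univ : Finset (ZMod (m * n + 1))) n, 2 ^ (#{i | c i ≠ 0} - 1) =
      ∑ r : ZMod (m * n + 1), if (fun i => c (i + r)) ∈ parkingContents m n then
        2 ^ (#{i | c i ≠ 0} - 1) else 0 := fun c hc => by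
    obtain ⟨r, hr, huniq⟩ :=
      existsUnique_rotation_mem_parkingContents (m := m) (mem_piAntidiag.mp hc).1
    rw [Finset.sum_eq_single r (fun s _ hs => if_neg fun h => hs (huniq s h)) (by simp), if_pos hr]
  rw [Finset.sum_congr rfl h1, Finset.sum_comm]
  have h2 : ∀ r : ZMod (m * n + 1), (∑ c ∈ piAntidiag (univ : Finset (ZMod (m * n + 1))) n,
      if (fun i => c (i + r)) ∈ parkingContents m n then 2 ^ (#{i | c i ≠ 0} - 1) else 0) =
      ∑ c ∈ parkingContents m n, 2 ^ (#{i | c i ≠ 0} - 1) := fun r => by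
    rw [← Finset.sum_filter]
    refine Finset.sum_bij (fun c _ i => c (i + r)) (fun c hc => (mem_filter.mp hc).2) ?_ ?_ ?_
    · intro c _ c' _ h
      ext i
      simpa using congr_fun h (i - r)
    · intro c hc
      refine ⟨fun i => c (i - r), ?_, by simp⟩
      have hc' := (mem_filter.mp hc).1
      simp only [mem_filter, mem_piAntidiag, mem_univ, implies_true, and_true] at hc' ⊢
      refine ⟨?_, by simpa using hc⟩
      exact (Fintype.sum_equiv (Equiv.subRight r) _ _ (by simp)).trans hc'
    · intro c _
      congr 2
      refine Finset.card_bij (fun i _ => i - r) (by simp) (by simp) fun i hi => ⟨i + r, ?_⟩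
      simpa using hi
  rw [Finset.sum_congr rfl fun r _ => h2 r]
  simp [ZMod.card]

open Finset in
theorem mul_sum_two_pow_parkingContents {m n : ℕ} (hm : 1 ≤ m) (hn : 1 ≤ n) :
    n * ∑ c ∈ parkingContents m n, 2 ^ (#{i | c i ≠ 0} - 1) =
      ∑ k ∈ Icc 1 n, (m * n).choose (k - 1) * n.choose k * 2 ^ (k - 1) := by
  have h := mul_sum_two_pow_piAntidiag (m * n) (ZMod (m * n + 1)) (ZMod.card _) hn
    (Nat.le_mul_of_pos_left n hm)
  rw [← sum_two_pow_parkingContents, mul_left_comm] at h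
  exact Nat.eq_of_mul_eq_mul_left (Nat.succ_pos _) h

/-! ### Parking functions and their contents -/

/-- A word of length `n` whose function of positions is an `m`-parking function. -/
def IsParkingWord (m n : ℕ) (w : List ℕ) : Prop :=
  w.length = n ∧ (∀ x ∈ w, 1 ≤ x) ∧ ∀ i < n, i < w.countP (· ≤ 1 + m * i)

theorem List.countP_ofFn_eq_card {α : Type} {n : ℕ} (f : Fin n → α) (p : α → Prop)
    [DecidablePred p] : (List.ofFn f).countP p = Finset.card {i | p (f i)} := by
  rw [List.ofFn_eq_map, List.countP_map, Finset.card_def, Finset.filter_val, Fin.univ_def,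
    ← Multiset.countP_eq_card_filter]
  simp [Function.comp_def]

/-- The entry of index `i` (from zero) in the sorted list is at most `v` exactly when more than `i`
values are at most `v`. -/
theorem isMParkingFunction_iff_isParkingWord {m n : ℕ} (f : Fin n → ℕ) :
    IsMParkingFunction m n f ↔ IsParkingWord m n (List.ofFn f) := by
  simp only [IsMParkingFunction, IsParkingWord, List.length_ofFn, true_and, List.mem_ofFn,
    forall_exists_index, forall_apply_eq_imp_iff, List.countP_ofFn_eq_card]
  refine and_congr Iff.rfl ?_
  have key : ∀ i : Fin n, f (Tuple.sort f i) ≤ 1 + m * (i : ℕ) ↔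
      (i : ℕ) < Finset.card {j | f j ≤ 1 + m * (i : ℕ)} := fun i => by
    have h := Tuple.lt_card_le_iff_apply_le_of_monotone (j := i) (a := 1 + m * (i : ℕ))
      (Tuple.monotone_sort f)
    rw [show f (Tuple.sort f i) = (f ∘ Tuple.sort f) i from rfl, ← h]
    refine Eq.to_iff (congrArg (fun k => (i : ℕ) < k) ?_)
    exact Finset.card_equiv (Tuple.sort f) (by simp)
  exact ⟨fun h i hi => (key ⟨i, hi⟩).mp (h ⟨i, hi⟩), fun h i => (key i).mpr (h i i.2)⟩

theorem mem_hypoplacticClasses_iff {m n : ℕ} {q : hypoplacticCon.Quotient} :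
    q ∈ hypoplacticClasses m n ↔
      ∃ w, IsParkingWord m n w ∧ q = (FreeMonoid.ofList w : hypoplacticCon.Quotient) := by
  constructor
  · rintro ⟨f, hf, rfl⟩
    exact ⟨_, (isMParkingFunction_iff_isParkingWord f).mp hf, rfl⟩
  · rintro ⟨w, hw, rfl⟩
    obtain rfl := hw.1
    refine ⟨w.get, (isMParkingFunction_iff_isParkingWord _).mpr (by rwa [List.ofFn_get]), ?_⟩
    rw [functionWord, List.ofFn_get]

theorem List.countP_le_eq_sum_count {w : List ℕ} (hw : ∀ x ∈ w, 1 ≤ x) (t : ℕ) :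
    w.countP (· ≤ t) = ∑ j ∈ Finset.range t, w.count (j + 1) := by
  induction t with
  | zero =>
    rw [Finset.sum_range_zero, List.countP_eq_zero]
    intro x hx
    have := hw x hx
    simp
    omega
  | succ t ih =>
    rw [Finset.sum_range_succ, ← ih]
    clear ih hw
    induction w with
    | nil => rfl
    | cons x w ih =>
      simp only [List.countP_cons, List.count_cons, ih, decide_eq_true_eq, beq_iff_eq]
      split_ifs <;> omega

/-- The multiplicity of the letter `v` in a word of content `c`. -/
def letterCount {L : ℕ} (c : ZMod L → ℕ) (v : ℕ) : ℕ :=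
  if 1 ≤ v ∧ v ≤ L then c (v - 1 : ℕ) else 0

theorem isParkingWord_iff_mem_parkingContents {m n : ℕ} (hm : 1 ≤ m) {w : List ℕ}
    {c : ZMod (m * n + 1) → ℕ} (h : ∀ v, w.count v = letterCount c v) :
    IsParkingWord m n w ↔ c ∈ parkingContents m n := by
  have hpos : ∀ x ∈ w, 1 ≤ x ∧ x ≤ m * n + 1 := fun x hx => by
    have := List.count_pos_iff.mpr hx
    rw [h, letterCount] at this
    split_ifs at this with h'
    · exact h'
    · simp at this
  have hprefix : ∀ t ≤ m * n + 1, w.countP (· ≤ t) = ∑ j ∈ Finset.range t, c j := fun t ht => by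
    rw [List.countP_le_eq_sum_count fun x hx => (hpos x hx).1]
    refine Finset.sum_congr rfl fun j hj => ?_
    have := Finset.mem_range.mp hj
    rw [h, letterCount, if_pos (by omega), Nat.add_sub_cancel]
  have hlen : w.length = ∑ i, c i := by
    rw [← ZMod.sum_range_natCast, ← hprefix _ le_rfl, eq_comm, List.countP_eq_length]
    simpa using fun x hx => (hpos x hx).2
  simp only [IsParkingWord, parkingContents, Finset.mem_filter, Finset.mem_piAntidiag,
    Finset.mem_univ, implies_true, and_true, hlen]
  refine and_congr Iff.rfl ⟨fun hw t ht => ?_, fun hc => ⟨fun x hx => (hpos x hx).1, fun i hi => ?_⟩⟩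
  · rcases Nat.eq_zero_or_pos t with rfl | h0
    · simp
    -- With `i = (t - 1) / m` one has `1 + m * i ≤ t ≤ m * (i + 1)`, so the `i + 1` letters at most
    -- `1 + m * i` suffice for the bound at `t`.
    have hi : (t - 1) / m < n := by
      rw [Nat.div_lt_iff_lt_mul (by omega), mul_comm]
      omega
    have h1 := hw.2 _ hi
    have h2 : 1 + m * ((t - 1) / m) ≤ t := by
      have := Nat.mul_div_le (t - 1) m
      omega
    have h3 := Nat.lt_mul_div_succ (t - 1) (show 0 < m by omega)
    rw [← hprefix t (by omega)]
    have h4 : w.countP (· ≤ 1 + m * ((t - 1) / m)) ≤ w.countP (· ≤ t) :=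
      List.countP_mono_left fun x _ hx => by
        simp only [decide_eq_true_eq] at hx ⊢
        omega
    have h5 := Nat.mul_le_mul_left m (show (t - 1) / m + 1 ≤ w.countP (· ≤ t) by omega)
    omega
  · have hlt : 1 + m * i < m * n + 1 := by
      have := Nat.mul_lt_mul_of_pos_left hi (show 0 < m by omega)
      omega
    have h1 := hc _ hlt
    rw [← hprefix _ hlt.le] at h1
    exact Nat.lt_of_mul_lt_mul_left (a := m) (by omega)

theorem IsParkingWord.le {m n : ℕ} {w : List ℕ} (hw : IsParkingWord m n w) (hn : 1 ≤ n) :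
    ∀ x ∈ w, x ≤ m * n + 1 := by
  have h := hw.2.2 (n - 1) (by omega)
  have h' : w.countP (· ≤ 1 + m * (n - 1)) = w.length :=
    le_antisymm List.countP_le_length (by rw [hw.1]; omega)
  intro x hx
  have h1 := List.countP_eq_length.mp h' x hx
  have h2 := Nat.mul_le_mul_left m (show n - 1 ≤ n by omega)
  simp only [decide_eq_true_eq] at h1
  omega

/-! ### Classes as pairs of a content and a descent set -/

/-- The letters of content `c` other than the smallest one. -/
def nonminimalLetters {L : ℕ} (c : ZMod L → ℕ) : Finset ℕ :=
  {b ∈ Finset.range (L + 1) | 0 < letterCount c b ∧ ∃ a < b, 0 < letterCount c a}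

theorem letterCount_pos_imp {L : ℕ} {c : ZMod L → ℕ} {v : ℕ} (h : 0 < letterCount c v) :
    1 ≤ v ∧ v ≤ L := by
  rw [letterCount] at h
  split_ifs at h with h'
  · exact h'
  · simp at h

theorem mem_nonminimalLetters {L : ℕ} {c : ZMod L → ℕ} {b : ℕ} :
    b ∈ nonminimalLetters c ↔ 0 < letterCount c b ∧ ∃ a < b, 0 < letterCount c a := by
  rw [nonminimalLetters, Finset.mem_filter, and_iff_right_iff_imp]
  intro h
  have := letterCount_pos_imp h.1
  simp
  omega

open Finset in
theorem card_nonminimalLetters {L : ℕ} [NeZero L] (c : ZMod L → ℕ) :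
    #(nonminimalLetters c) = #{i | c i ≠ 0} - 1 := by
  set S : Finset ℕ := {b ∈ range (L + 1) | 0 < letterCount c b} with hS
  have hmem : ∀ b, b ∈ S ↔ 0 < letterCount c b := fun b => by
    rw [hS, mem_filter, and_iff_right_iff_imp]
    intro h
    have := letterCount_pos_imp h
    simp
    omega
  have hcard : #{i | c i ≠ 0} = #S := by
    refine Finset.card_bij (fun i _ => i.val + 1) ?_ ?_ ?_
    · intro i hi
      have := ZMod.val_lt i
      rw [hmem, letterCount, if_pos (by omega), Nat.add_sub_cancel, ZMod.natCast_zmod_val]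
      simp at hi
      omega
    · intro i _ j _ h
      exact ZMod.val_injective L (by omega)
    · intro b hb
      rw [hmem] at hb
      have h := letterCount_pos_imp hb
      rw [letterCount, if_pos h] at hb
      refine ⟨((b - 1 : ℕ) : ZMod L), by simpa using hb.ne', ?_⟩
      rw [ZMod.val_natCast_of_lt (by omega)]
      omega
  rw [hcard]
  rcases S.eq_empty_or_nonempty with he | hne
  · rw [he, Finset.card_eq_zero.mpr]
    · simp
    · refine Finset.eq_empty_of_forall_notMem fun b hb => ?_
      have := (hmem b).mpr (mem_nonminimalLetters.mp hb).1
      simp [he] at this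
  · rw [← Finset.card_erase_of_mem (S.min'_mem hne)]
    congr 1
    ext b
    rw [mem_nonminimalLetters, mem_erase, hmem, and_comm]
    refine and_congr_left fun hb => ⟨?_, fun h => ?_⟩
    · rintro ⟨a, hab, ha⟩ rfl
      exact (S.min'_le a ((hmem a).mpr ha)).not_gt hab
    · exact ⟨S.min' hne, lt_of_le_of_ne (S.min'_le b ((hmem b).mpr hb)) (Ne.symm h),
        (hmem _).mp (S.min'_mem hne)⟩

open Finset in
theorem ncard_hypoplacticClasses {m n : ℕ} (hm : 1 ≤ m) (hn : 1 ≤ n) :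
    (hypoplacticClasses m n).ncard =
      ∑ c ∈ parkingContents m n, 2 ^ (#{i | c i ≠ 0} - 1) := by
  classical
  -- Letters run over `1, …, m * n + 1`, hence the strict bound `m * n + 2`.
  let word : (_ : ZMod (m * n + 1) → ℕ) × Finset ℕ → List ℕ := fun p =>
    quasiRibbonWord (letterCount p.1) (· ∈ p.2) (m * n + 2)
  let T := (parkingContents m n).sigma fun c => (nonminimalLetters c).powerset
  have hcount : ∀ p, ∀ v, (word p).count v = letterCount p.1 v := fun p v => by
    rw [count_quasiRibbonWord]
    split_ifs with hv
    · rfl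
    · by_contra h
      have := letterCount_pos_imp (Nat.pos_of_ne_zero (Ne.symm h))
      omega
  have hdesc : ∀ p ∈ T, ∀ b < m * n + 2, (word p).Descent b ↔ b ∈ p.2 := fun p hp b hb =>
    descent_quasiRibbonWord (fun b hb => mem_nonminimalLetters.mp
      ((mem_powerset.mp (mem_sigma.mp hp).2) hb)) hb
  have himage : hypoplacticClasses m n =
      ((T.image fun p => ((FreeMonoid.ofList (word p) : FreeMonoid ℕ) : hypoplacticCon.Quotient) :
        Finset _) : Set hypoplacticCon.Quotient) := by
    ext q
    rw [mem_hypoplacticClasses_iff, coe_image, Set.mem_image]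
    constructor
    · rintro ⟨w, hw, rfl⟩
      let c : ZMod (m * n + 1) → ℕ := fun i => w.count (i.val + 1)
      have hc : ∀ v, w.count v = letterCount c v := fun v => by
        rw [letterCount]
        split_ifs with hv
        · simp only [c]
          rw [ZMod.val_natCast_of_lt (by omega), Nat.sub_add_cancel hv.1]
        · rw [List.count_eq_zero]
          exact fun h => hv ⟨hw.2.1 v h, hw.le hn v h⟩
      let D : Finset ℕ := {b ∈ nonminimalLetters c | w.Descent b}
      refine ⟨⟨c, D⟩, ?_, ?_⟩
      · rw [mem_coe, mem_sigma, mem_powerset]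
        exact ⟨(isParkingWord_iff_mem_parkingContents hm hc).mp hw, filter_subset _ _⟩
      · refine Eq.symm ((Con.eq _).mpr ?_)
        have h := hypoplacticCon_quasiRibbonWord (M := m * n + 2) (w := w) fun x hx =>
          Nat.lt_succ_of_le (hw.le hn x hx)
        rwa [quasiRibbonWord_congr fun b _ => ⟨hc b, ?_⟩] at h
        simp only [D, mem_filter, mem_nonminimalLetters, iff_and_self, ← hc]
        rintro ⟨a, hab, hs, -⟩
        exact ⟨List.count_pos_iff.mpr (hs.subset (by simp)), a, hab,
          List.count_pos_iff.mpr (hs.subset (by simp))⟩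
    · rintro ⟨p, hp, rfl⟩
      exact ⟨word p, (isParkingWord_iff_mem_parkingContents hm (hcount p)).mpr
        (mem_sigma.mp hp).1, rfl⟩
  -- The content and the descent set are recovered from the class by invariance.
  have hinj : Set.InjOn (fun p => ((FreeMonoid.ofList (word p) : FreeMonoid ℕ) :
      hypoplacticCon.Quotient)) T := by
    rintro ⟨c, D⟩ hp ⟨c', D'⟩ hp' h
    have h := count_eq_and_descent_iff_of_hypoplacticCon ((Con.eq _).mp h)
    obtain rfl : c = c' := by
      ext i
      have h1 := (h (i.val + 1)).1
      have := ZMod.val_lt i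
      rw [hcount, hcount, letterCount, letterCount, if_pos (by omega), if_pos (by omega)] at h1
      simpa using h1
    obtain rfl : D = D' := by
      ext b
      have hlt : ∀ p ∈ T, b ∈ p.2 → b < m * n + 2 := fun p hp hb => by
        have := letterCount_pos_imp (mem_nonminimalLetters.mp
          ((mem_powerset.mp (mem_sigma.mp hp).2) hb)).1
        omega
      constructor <;> intro hb
      · have hb' := hlt _ hp hb
        rwa [← hdesc _ hp b hb', (h b).2, hdesc _ hp' b hb'] at hb
      · have hb' := hlt _ hp' hb
        rwa [← hdesc _ hp' b hb', ← (h b).2, hdesc _ hp b hb'] at hb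
    rfl
  rw [himage, Set.ncard_coe_finset, card_image_of_injOn hinj, card_sigma]
  simp only [card_powerset, card_nonminimalLetters]

theorem mainTheorem11 (m n : ℕ) (hm : 1 ≤ m) (hn : 1 ≤ n) :
    ((hypoplacticClasses m n).ncard : ℚ) =
      (1 / (n : ℚ)) * ∑ k ∈ Finset.Icc 1 n,
        ((m * n).choose (k - 1) : ℚ) * (n.choose k : ℚ) * 2 ^ (k - 1) := by
  have h := mul_sum_two_pow_parkingContents hm hn
  rw [← ncard_hypoplacticClasses hm hn] at h
  have h' : (n : ℚ) * (hypoplacticClasses m n).ncard = ∑ k ∈ Finset.Icc 1 n,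
      ((m * n).choose (k - 1) : ℚ) * (n.choose k : ℚ) * 2 ^ (k - 1) := by
    exact_mod_cast h
  have hn' : (n : ℚ) ≠ 0 := by
    have : n ≠ 0 := by omega
    exact_mod_cast this
  rw [← h']
  field_simp
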